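/- **Notation.** $B_i$ is the $i$-th Bernoulli number ($B_1=-\tfrac12$) and $B_i(x)$ the $i$-th Bernoulli polynomial. $\bar B_i(x)=B_i(x-\lfloor x\rfloor)$, except that $\bar B_1(x)=0$ for $x\in\mathbb Z$. For positive integers $i,j$, $$s_{i,j}(p,q)=\sum_{k=0}^{q-1}\bar B_i\!\left(\tfrac kq\right)\bar B_j\!\left(\tfrac{pk}q\right),$$ and $\delta(i,j)=1$ if $i=1$ or $j=1$, $\delta(i,j)=0$ otherwise. Let $0<p<q$ be coprime integers and let $$\frac qp=[a_1,\dots,a_n]=a_1+\cfrac1{a_2+\cfrac1{\ddots+\cfrac1{a_n}}}$$ with $n\ge 1$ and positive integers $a_1,\dots,a_n$ (either of the two such expansions). Put $(p_{-1},q_{-1})=(1,0)$, $(p_0,q_0)=(0,1)$, and for $1\le k\le n$ let $q_k/p_k=[a_1,\dots,a_k]$ in lowest terms with $p_k,q_k>0$. Put $D_k=pq_k-qp_k$ for $-1\le k\le n$. Let $e,f$ be positive integers with $N=e+f$ even. With $0^0=1$, for $\alpha,\beta\ge 0$ with $\alpha+\beta=e-1$ let $$f_k(\alpha,\beta)=\frac{q_k^{\beta}q_{k+1}^{\alpha}}{\alpha!\,\beta!}\sum_{i=\alpha}^{N-2-\beta}\frac{(-1)^i}{(N-2-i-\beta)!\,(i-\alpha)!}\,\frac{B_{i+1}}{i+1}\,\frac{B_{N-i-1}}{N-i-1}\,D_k^{N-2-i-\beta}D_{k+1}^{i-\alpha},$$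 $$g_k(\alpha,\beta)=\frac{q_{k-1}^{\beta}q_{k+1}^{\alpha}}{\alpha!\,\beta!}\sum_{i=\alpha}^{N-2-\beta}\frac{(N-i-2)!}{(N-2-i-\beta)!}\,\frac{i!}{(i-\alpha)!}\,D_{k-1}^{N-i-2-\beta}D_{k+1}^{i-\alpha},$$ $$I_{e,f}=\sum_{\alpha+\beta=e-1}\Big[\sum_{k=-1}^{n-1}(-1)^{k+1}f_k(\alpha,\beta)+\frac{B_N}{N!}\sum_{k=0}^{n-1}(-1)^ka_{k+1}\,g_k(\alpha,\beta)\Big],$$ and set $$s^I_{e,f}(p,q)=e!\,f!\,I_{e,f},\qquad s^R_{e,f}(p,q)=e!\,f!\,\frac{B_N}{N!}\Big[\binom{N-1}{f}p^f+(-1)^{e(n-1)}\binom{N-1}{e}q_{n-1}^{\,e}\Big].$$ For linearly independent $v_1,v_2\in\mathbb Z^2$, the Todd power series of the cone generated by $v_1,v_2$ is $$\mathrm{Td}_{v_1,v_2}(x_1,x_2)=\sum_{\gamma\in\mathbb Z^2/(\mathbb Zv_1+\mathbb Zv_2)}\frac{x_1}{1-\chi_1(\gamma)e^{-x_1}}\cdot\frac{x_2}{1-\chi_2(\gamma)e^{-x_2}}\in\mathbb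 C[[x_1,x_2]],$$ where $\chi_i(\gamma)=e^{2\pi\sqrt{-1}\,c_i}$ if $\gamma$ is represented by $c_1v_1+c_2v_2$ with $c_1,c_2\in\mathbb Q$; the quotients are expanded at $x_i=0$, the singularity being removable when $\chi_i(\gamma)=1$. Let $\mathrm{Td}_{pq}=\mathrm{Td}_{(1,0),(p,q)}$. **Theorem.** With these notations: 1. $$s_{e,f}(p,q)+\delta(e,f)B_eB_f=\frac{1}{q^{N-2}}\,s^I_{e,f}(p,q)+\frac1{q^{N-1}}\,s^R_{e,f}(p,q).$$ 2. The coefficient of $x_1^{e}x_2^{f}$ in $\mathrm{Td}_{pq}(x_1,x_2)$ is $$q\,I_{e,f}+\frac{B_N}{N!}\binom{N-1}{f}p^{f}+\frac{B_N}{N!}\binom{N-1}{e}\big((-1)^{n-1}q_{n-1}\big)^{e}.$$ -/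

import Mathlib

namespace GenDedekind

/-! ### Generalized Dedekind sums -/

/-- The `i`-th periodic Bernoulli function, `x ↦ B_i({x})`. For `i = 1` it is the sawtooth function,
which takes the value `0` at the integers. -/
noncomputable def periodicBernoulli (i : ℕ) (x : ℚ) : ℚ :=
  if i = 1 ∧ Int.fract x = 0 then 0 else (Polynomial.bernoulli i).eval (Int.fract x)

/-- `s_{i,j}(p,q)`. -/
noncomputable def dedekindSum (i j p q : ℕ) : ℚ :=
  ∑ k ∈ Finset.range q,
    periodicBernoulli i ((k : ℚ) / q) * periodicBernoulli j ((p : ℚ) * k / q)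

/-- `δ(i,j)` is `1` if `i = 1` or `j = 1`, and `0` otherwise. -/
def delta (i j : ℕ) : ℚ := if i = 1 ∨ j = 1 then 1 else 0

/-! ### Continued fractions -/

/-- The value of the finite continued fraction `b₁ + 1 / (b₂ + 1 / (⋯ + 1 / bₘ))`;
the inverse of the empty value `0` is `0`, so that a one-term list has value `b₁`. -/
def contFrac : List ℕ → ℚ
  | [] => 0
  | b :: l => b + (contFrac l)⁻¹

/-- `[a₁, …, aₘ]`, the sequence being indexed from `1`. -/
def contFracTo (a : ℕ → ℕ) (m : ℕ) : ℚ := contFrac ((List.range m).map fun i => a (i + 1))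

/-- `p_k`, for `k ≥ -1`: `p_{-1} = 1`, `p_0 = 0`, and for `k ≥ 1` the denominator of
`q_k / p_k = [a₁, …, a_k]` in lowest terms. -/
def convP (a : ℕ → ℕ) (k : ℤ) : ℤ :=
  if k = -1 then 1 else if k = 0 then 0 else ((contFracTo a k.toNat).den : ℤ)

/-- `q_k`, for `k ≥ -1`: `q_{-1} = 0`, `q_0 = 1`, and for `k ≥ 1` the numerator of
`q_k / p_k = [a₁, …, a_k]` in lowest terms. -/
def convQ (a : ℕ → ℕ) (k : ℤ) : ℤ :=
  if k = -1 then 0 else if k = 0 then 1 else (contFracTo a k.toNat).num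

/-- `D_k = p q_k - q p_k`. -/
def convD (p q : ℕ) (a : ℕ → ℕ) (k : ℤ) : ℤ := p * convQ a k - q * convP a k

/-! ### The integral and the fractional part -/

/-- `f_k(α,β)`, for a given weight `N`. -/
def fTerm (p q : ℕ) (a : ℕ → ℕ) (N : ℕ) (k : ℤ) (α β : ℕ) : ℚ :=
  (convQ a k : ℚ) ^ β * (convQ a (k + 1) : ℚ) ^ α / (α.factorial * β.factorial) *
    ∑ i ∈ Finset.Icc α (N - 2 - β),
      (-1) ^ i / (((N - 2 - i - β).factorial : ℚ) * ((i - α).factorial : ℚ)) *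
        (bernoulli (i + 1) / ((i + 1 : ℕ) : ℚ)) *
        (bernoulli (N - i - 1) / ((N - i - 1 : ℕ) : ℚ)) *
        (convD p q a k : ℚ) ^ (N - 2 - i - β) * (convD p q a (k + 1) : ℚ) ^ (i - α)

/-- `g_k(α,β)`, for a given weight `N`. -/
def gTerm (p q : ℕ) (a : ℕ → ℕ) (N : ℕ) (k : ℤ) (α β : ℕ) : ℚ :=
  (convQ a (k - 1) : ℚ) ^ β * (convQ a (k + 1) : ℚ) ^ α / (α.factorial * β.factorial) *
    ∑ i ∈ Finset.Icc α (N - 2 - β),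
      ((N - i - 2).factorial : ℚ) / ((N - 2 - i - β).factorial : ℚ) *
        ((i.factorial : ℚ) / ((i - α).factorial : ℚ)) *
        (convD p q a (k - 1) : ℚ) ^ (N - i - 2 - β) * (convD p q a (k + 1) : ℚ) ^ (i - α)

/-- The sum over `α + β = e - 1` of
`∑_{k=-1}^{n-1} (-1)^{k+1} f_k(α,β) + B_N/N! ∑_{k=0}^{n-1} (-1)^k a_{k+1} g_k(α,β)`,
with `N = e + f`; the first inner sum is written with `k = j - 1`, `0 ≤ j ≤ n`. -/
def integralCoeff (e f p q n : ℕ) (a : ℕ → ℕ) : ℚ :=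
  ∑ x ∈ Finset.HasAntidiagonal.antidiagonal (e - 1),
    ((∑ j ∈ Finset.range (n + 1), (-1) ^ j * fTerm p q a (e + f) ((j : ℤ) - 1) x.1 x.2) +
      bernoulli (e + f) / ((e + f).factorial : ℚ) *
        ∑ k ∈ Finset.range n, (-1) ^ k * (a (k + 1) : ℚ) * gTerm p q a (e + f) (k : ℤ) x.1 x.2)

/-- `s^I_{e,f}(p,q)`, computed from the expansion `q / p = [a₁, …, aₙ]`. -/
def integralPart (e f p q n : ℕ) (a : ℕ → ℕ) : ℚ :=
  (e.factorial : ℚ) * (f.factorial : ℚ) * integralCoeff e f p q n a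

/-- `s^R_{e,f}(p,q)`, computed from the expansion `q / p = [a₁, …, aₙ]`. -/
def fractionalPart (e f p n : ℕ) (a : ℕ → ℕ) : ℚ :=
  (e.factorial : ℚ) * (f.factorial : ℚ) * (bernoulli (e + f) / ((e + f).factorial : ℚ)) *
    (((e + f - 1).choose f : ℚ) * (p : ℚ) ^ f +
      (-1) ^ (e * (n - 1)) * ((e + f - 1).choose e : ℚ) * (convQ a ((n : ℤ) - 1) : ℚ) ^ e)

/-! ### Todd power series of a two-dimensional lattice cone -/

/-- The formal power series of `x / (1 - c e^{-x})` at `x = 0`. For `c = 1` the factor `x` is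
cancelled first, which makes the denominator invertible. -/
noncomputable def toddFactor (c : ℂ) : PowerSeries ℂ :=
  if c = 1 then
    (PowerSeries.mk fun n =>
      PowerSeries.coeff (n + 1) (1 - PowerSeries.evalNegHom (PowerSeries.exp ℂ)))⁻¹
  else PowerSeries.X * (1 - PowerSeries.C c * PowerSeries.evalNegHom (PowerSeries.exp ℂ))⁻¹

/-- `toddFactor c` is the quotient `x / (1 - c e^{-x})`. -/
theorem toddFactor_mul (c : ℂ) :
    toddFactor c * (1 - PowerSeries.C c * PowerSeries.evalNegHom (PowerSeries.exp ℂ)) =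
      PowerSeries.X := by
  have h0 : PowerSeries.constantCoeff (PowerSeries.evalNegHom (PowerSeries.exp ℂ)) = 1 := by
    simp [PowerSeries.evalNegHom, ← PowerSeries.coeff_zero_eq_constantCoeff_apply,
      PowerSeries.coeff_rescale]
  unfold toddFactor
  split_ifs with hc
  · subst hc
    set G : PowerSeries ℂ := PowerSeries.mk fun n =>
      PowerSeries.coeff (n + 1) (1 - PowerSeries.evalNegHom (PowerSeries.exp ℂ)) with hG
    have h1 : PowerSeries.constantCoeff G ≠ 0 := by
      rw [← PowerSeries.coeff_zero_eq_constantCoeff_apply, hG, PowerSeries.coeff_mk]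
      simp [PowerSeries.evalNegHom, PowerSeries.coeff_rescale, PowerSeries.coeff_exp,
        PowerSeries.coeff_one]
    have h2 : 1 - PowerSeries.C (1 : ℂ) * PowerSeries.evalNegHom (PowerSeries.exp ℂ) =
        G * PowerSeries.X := by
      ext n
      cases n with
      | zero => simp [h0]
      | succ m => rw [PowerSeries.coeff_succ_mul_X, hG, PowerSeries.coeff_mk]; simp
    rw [h2, ← mul_assoc, PowerSeries.inv_mul_cancel _ h1, one_mul]
  · have h1 : PowerSeries.constantCoeff
        (1 - PowerSeries.C c * PowerSeries.evalNegHom (PowerSeries.exp ℂ)) ≠ 0 := by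
      simpa [h0, sub_eq_zero] using fun h : 1 = c => hc h.symm
    rw [mul_assoc, PowerSeries.inv_mul_cancel _ h1, mul_one]

/-- The matrix `A_σ` whose columns are the generators `v₁`, `v₂` of the cone `σ`. -/
def coneMatrix (v₁ v₂ : Fin 2 → ℤ) : Matrix (Fin 2) (Fin 2) ℚ :=
  Matrix.of fun i j => ((![v₁, v₂] j i : ℤ) : ℚ)

/-- The sublattice `M_σ` of `ℤ²` generated by `v₁` and `v₂`. -/
def coneLattice (v₁ v₂ : Fin 2 → ℤ) : AddSubgroup (Fin 2 → ℤ) := AddSubgroup.closure {v₁, v₂}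

/-- The coordinates of `g` in the basis `v₁, v₂` of `ℚ²`. -/
noncomputable def coneCoord (v₁ v₂ g : Fin 2 → ℤ) : Fin 2 → ℚ :=
  (coneMatrix v₁ v₂)⁻¹.mulVec fun i => (g i : ℚ)

/-- The two characters of `Γ_σ = ℤ² / M_σ`: the exponential `exp(2πi ·)` of a coordinate of a
representative (independent of the representative when `v₁`, `v₂` are linearly independent). -/
noncomputable def coneChar (v₁ v₂ : Fin 2 → ℤ) (i : Fin 2)
    (γ : (Fin 2 → ℤ) ⧸ coneLattice v₁ v₂) : ℂ :=
  Complex.exp (2 * Real.pi * Complex.I * ((coneCoord v₁ v₂ γ.out i : ℚ) : ℂ))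

/-- The Todd power series of the cone generated by `v₁`, `v₂` (linearly independent, so that the
group `ℤ² / M_σ` is finite), in the variables `x₁ = X 0` and `x₂ = X 1`. -/
noncomputable def toddSeries (v₁ v₂ : Fin 2 → ℤ) : MvPowerSeries (Fin 2) ℂ :=
  ∑ᶠ γ : (Fin 2 → ℤ) ⧸ coneLattice v₁ v₂,
    (toddFactor (coneChar v₁ v₂ 0 γ)).subst (MvPowerSeries.X 0 : MvPowerSeries (Fin 2) ℂ) *
      (toddFactor (coneChar v₁ v₂ 1 γ)).subst (MvPowerSeries.X 1 : MvPowerSeries (Fin 2) ℂ)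

end GenDedekind

/-! For N = e + f, collect the sums of products B_e({k/q}) B_f({pk/q}) (with B_1(0) = -1/2) into a
homogeneous rational function S_{p,q}(A,B) of degree N - 2, called `sumForm`. Clearing denominators
in its generating function leaves sums such as ∑ u^k v^⌊pk/q⌋, which run over the columns of a
lattice staircase. Counting the staircase by rows instead gives reciprocity: S_{p,q}(A,B) +
S_{q,p}(M,B) = S_{0,1}(A,M) whenever B = qM + pA (`bernoulliSeries_reciprocity`,
`sumForm_reciprocity`).

As S_{p,q} depends only on p mod q, reciprocity can be iterated by Euclid's algorithm. Along the
continued fraction, S_{p,q} becomes an alternating sum of S_{0,1}(l_k, l_{k+1}), where l_{k+2} = c_k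
l_{k+1} + l_k and c_k = a_{k+1} (`sumForm_contFrac`). The poles on the interior l_{k+1} combine into
(l_{k+2}^{N-1} - l_k^{N-1}) / l_{k+1}, which is c_k times a geometric sum (`alternating_sumForm`).
The regular parts give the terms f_k, the geometric sums give the g_k, and the poles at the two ends
survive as the fractional part.

Taking for l_k the linear polynomials q_k x + D_k (index shifted by one) makes the ends -q and qx,
so the identity becomes polynomial in x (`bernoulliSum_polynomial`), and the formula is a comparison
of coefficients.

For the Todd series, the cone group is cyclic of order q. Each factor expands in Bernoulli series at
k/q, and orthogonality of characters identifies the coefficient with q^{N-1} / (e! f!) times the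
same Bernoulli sum (`coeff_toddSeries`). -/

namespace GenDedekind

open Finset

/-! ### Lattice points on the two sides of a line -/

/-- Summation by parts along the boundary of the staircase below the line of slope `p / q`. -/
theorem staircase_identity {R : Type*} [CommRing R] (u v : R) {m q : ℕ} (hq : 0 < q)
    (hcop : Nat.Coprime (m + 1) q) :
    (u - 1) * ∑ k ∈ range q, u ^ k * v ^ ((m + 1) * k / q) +
      (v - 1) * ∑ j ∈ range m, v ^ j * u ^ (q * (j + 1) / (m + 1) + 1) = u ^ q * v ^ m - 1 := by
  have tele : ∀ (w : R) (n : ℕ), ∑ k ∈ range n, (w ^ (k + 1) - w ^ k) = w ^ n - 1 := fun w n => by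
    rw [sum_range_sub (fun k => w ^ k)]; simp
  have hA : ∀ k ∈ range q, ∑ j ∈ range m,
      (if q * (j + 1) ≤ (m + 1) * k then (u ^ (k + 1) - u ^ k) * (v ^ (j + 1) - v ^ j) else 0) =
      (u ^ (k + 1) - u ^ k) * (v ^ ((m + 1) * k / q) - 1) := by
    intro k hk
    rw [mem_range] at hk
    rw [← tele v, mul_sum, ← sum_filter]
    refine sum_congr ?_ fun _ _ => rfl
    ext j
    rw [mem_filter, mem_range, mem_range, Nat.lt_iff_add_one_le (n := (m + 1) * k / q),
      Nat.le_div_iff_mul_le hq, mul_comm (j + 1)]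
    refine ⟨fun h => h.2, fun h => ⟨?_, h⟩⟩
    by_contra! hj
    have : q * (m + 1) ≤ q * (j + 1) := Nat.mul_le_mul_left _ (by omega)
    have : (m + 1) * k < (m + 1) * q := Nat.mul_lt_mul_of_pos_left hk (by omega)
    linarith [mul_comm q (m + 1)]
  have hB : ∀ j ∈ range m, ∑ k ∈ range q,
      (if q * (j + 1) ≤ (m + 1) * k then 0 else (u ^ (k + 1) - u ^ k) * (v ^ (j + 1) - v ^ j)) =
      (v ^ (j + 1) - v ^ j) * (u ^ (q * (j + 1) / (m + 1) + 1) - 1) := by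
    intro j hj
    rw [mem_range] at hj
    -- By coprimality no lattice point of the rectangle lies on the line, so the complement of the
    -- column condition can be counted with a weak inequality.
    have hne : ∀ k, q * (j + 1) ≠ (m + 1) * k := by
      intro k h
      have : m + 1 ∣ j + 1 := hcop.dvd_of_dvd_mul_left ⟨k, h⟩
      have := Nat.le_of_dvd (by omega) this
      omega
    have hlt : q * (j + 1) / (m + 1) < q := by
      rw [Nat.div_lt_iff_lt_mul (by omega)]
      exact Nat.mul_lt_mul_of_pos_left (by omega) hq
    rw [← tele u, mul_sum]
    simp_rw [← ite_not (p := q * (j + 1) ≤ (m + 1) * _)]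
    rw [← sum_filter]
    refine sum_congr ?_ fun _ _ => by ring
    ext k
    rw [mem_filter, mem_range, mem_range, Nat.lt_succ_iff, Nat.le_div_iff_mul_le (by omega),
      not_le, mul_comm k]
    have := hne k
    constructor
    · rintro ⟨_, h⟩; exact h.le
    · intro h
      refine ⟨?_, by omega⟩
      have : k ≤ q * (j + 1) / (m + 1) := by
        rwa [Nat.le_div_iff_mul_le (by omega), mul_comm]
      omega
  have hAB : (∑ k ∈ range q, (u ^ (k + 1) - u ^ k) * (v ^ ((m + 1) * k / q) - 1)) +
      ∑ j ∈ range m, (v ^ (j + 1) - v ^ j) * (u ^ (q * (j + 1) / (m + 1) + 1) - 1) =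
      (u ^ q - 1) * (v ^ m - 1) := by
    rw [← sum_congr rfl hA, ← sum_congr rfl hB, sum_comm (s := range m), ← sum_add_distrib,
      ← tele u q, ← tele v m, sum_mul_sum]
    refine sum_congr rfl fun k _ => ?_
    rw [← sum_add_distrib]
    refine sum_congr rfl fun j _ => ?_
    split_ifs <;> simp
  have h1 : (u - 1) * ∑ k ∈ range q, u ^ k * v ^ ((m + 1) * k / q) =
      (∑ k ∈ range q, (u ^ (k + 1) - u ^ k) * (v ^ ((m + 1) * k / q) - 1)) + (u ^ q - 1) := by
    rw [← tele u q, ← sum_add_distrib, mul_sum]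
    exact sum_congr rfl fun _ _ => by ring
  have h2 : (v - 1) * ∑ j ∈ range m, v ^ j * u ^ (q * (j + 1) / (m + 1) + 1) =
      (∑ j ∈ range m, (v ^ (j + 1) - v ^ j) * (u ^ (q * (j + 1) / (m + 1) + 1) - 1)) +
        (v ^ m - 1) := by
    rw [← tele v m, ← sum_add_distrib, mul_sum]
    exact sum_congr rfl fun _ _ => by ring
  linear_combination h1 + h2 + hAB

/-! ### Bernoulli generating functions and their reciprocity -/

section GeneratingFunction

variable {K : Type*} [Field K] [CharZero K]

/-- The power series `e^{zt}` in `t`. -/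
noncomputable def expSeries (z : K) : PowerSeries K := PowerSeries.rescale z (PowerSeries.exp K)

theorem expSeries_add (z w : K) : expSeries (z + w) = expSeries z * expSeries w :=
  (PowerSeries.exp_mul_exp_eq_exp_add z w).symm

theorem expSeries_zero : expSeries (0 : K) = 1 := by
  simp [expSeries]

theorem expSeries_nat_mul (n : ℕ) (z : K) : expSeries (n * z) = expSeries z ^ n := by
  induction n with
  | zero => simp [expSeries_zero]
  | succ n ih => rw [pow_succ, ← ih, ← expSeries_add]; push_cast; ring_nf

theorem expSeries_sub_one_ne_zero {z : K} (hz : z ≠ 0) : expSeries z - 1 ≠ 0 := by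
  intro h
  have := congrArg (PowerSeries.coeff 1) h
  simp [expSeries, PowerSeries.coeff_rescale, PowerSeries.coeff_exp, PowerSeries.coeff_one] at this
  exact hz this

/-- The generating function `zt e^{szt} / (e^{zt} - 1)` of the Bernoulli polynomials at `s`. -/
noncomputable def bernoulliSeries (s : ℚ) (z : K) : PowerSeries K :=
  PowerSeries.mk fun n => (((Polynomial.bernoulli n).eval s / n.factorial : ℚ) : K) * z ^ n

theorem bernoulliSeries_mul (s : ℚ) (z : K) :
    bernoulliSeries s z * (expSeries z - 1) =
      PowerSeries.C z * PowerSeries.X * expSeries (s * z) := by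
  have h := congrArg (PowerSeries.rescale z)
    (Polynomial.bernoulli_generating_function (A := K) (s : K))
  rw [map_mul, map_mul, map_sub, map_one, PowerSeries.rescale_X, PowerSeries.rescale_rescale] at h
  convert h using 2
  · ext n
    simp only [bernoulliSeries, PowerSeries.coeff_mk, PowerSeries.coeff_rescale]
    rw [← eq_ratCast (algebraMap ℚ K) s, Polynomial.aeval_algebraMap_apply, eq_ratCast, mul_comm,
      Polynomial.coe_aeval_eq_eval, Polynomial.eval_smul, smul_eq_mul]
    congr 2
    ring
  · rfl
  · rfl

/-- The reflection B_n(1 - s) = (-1)^n B_n(s) at the level of generating functions. -/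
theorem bernoulliSeries_neg_mul (s : ℚ) (z : K) :
    bernoulliSeries s (-z) * (expSeries z - 1) =
      PowerSeries.C z * PowerSeries.X * expSeries ((1 - s) * z) := by
  have h := bernoulliSeries_mul s (-z)
  have h1 : expSeries (-z) * expSeries z = 1 := by
    rw [← expSeries_add, neg_add_cancel, expSeries_zero]
  have h2 : expSeries ((1 - s) * z) = expSeries (s * -z) * expSeries z := by
    rw [← expSeries_add]; ring_nf
  rw [h2]
  rw [map_neg] at h
  linear_combination -expSeries z * h + bernoulliSeries s (-z) * h1

end GeneratingFunction

/-- Reciprocity for the generating functions of the generalized Dedekind sums. -/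
theorem bernoulliSeries_reciprocity {K : Type*} [Field K] [CharZero K] {p q : ℕ} (hp : 0 < p)
    (hq : 0 < q) (hcop : Nat.Coprime p q)
    {M a B : K} (hM : M ≠ 0) (ha : a ≠ 0) (hB : B ≠ 0) (h : B = q * M - p * a) :
    PowerSeries.C M * ∑ k ∈ range q,
        bernoulliSeries ((k : ℚ) / q) B * bernoulliSeries (((p * k % q : ℕ) : ℚ) / q) a -
      PowerSeries.C a * ∑ k ∈ range p,
        bernoulliSeries ((k : ℚ) / p) B * bernoulliSeries (((q * k % p : ℕ) : ℚ) / p) (-M) =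
      PowerSeries.C B * (bernoulliSeries 0 M * bernoulliSeries 0 a) +
        PowerSeries.C a * PowerSeries.X *
          (PowerSeries.C B * bernoulliSeries 0 M - PowerSeries.C M * bernoulliSeries 0 B) := by
  obtain ⟨m, rfl⟩ : ∃ m, p = m + 1 := ⟨p - 1, by omega⟩
  set u := expSeries M with hu
  set v := expSeries (-a) with hv
  set w := expSeries a with hw
  have hvw : v * w = 1 := by rw [hv, hw, ← expSeries_add, neg_add_cancel, expSeries_zero]
  have hst := staircase_identity u v hq hcop
  have heB : expSeries B = u ^ q * v ^ (m + 1) := by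
    rw [hu, hv, ← expSeries_nat_mul, ← expSeries_nat_mul, ← expSeries_add, h]
    push_cast; ring_nf
  have hq' : (q : K) ≠ 0 := by exact_mod_cast hq.ne'
  have hm' : ((m : K) + 1) ≠ 0 := by exact_mod_cast (Nat.succ_ne_zero m)
  have hdm : ∀ x y : ℕ, (x : K) = y * (x / y : ℕ) + (x % y : ℕ) := fun x y => by
    exact_mod_cast (Nat.div_add_mod x y).symm
  have e1 : ∀ k ∈ range q, bernoulliSeries ((k : ℚ) / q) B *
      bernoulliSeries ((((m + 1) * k % q : ℕ) : ℚ) / q) a * ((expSeries B - 1) * (w - 1)) =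
      PowerSeries.C B * PowerSeries.C a * PowerSeries.X ^ 2 * (u ^ k * v ^ ((m + 1) * k / q)) := by
    intro k _
    have h1 := bernoulliSeries_mul ((k : ℚ) / q) B
    have h2 := bernoulliSeries_mul ((((m + 1) * k % q : ℕ) : ℚ) / q) a
    -- The exponents add up to (k/q)B + {pk/q}a = kM - ⌊pk/q⌋a, because B = qM - pa.
    have h3 : expSeries ((((k : ℚ) / q : ℚ) : K) * B) *
        expSeries ((((((m + 1) * k % q : ℕ) : ℚ) / q : ℚ) : K) * a) =
        u ^ k * v ^ ((m + 1) * k / q) := by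
      rw [← expSeries_add, hu, hv, ← expSeries_nat_mul, ← expSeries_nat_mul, ← expSeries_add]
      congr 1
      have := hdm ((m + 1) * k) q
      rw [h]
      push_cast at this ⊢
      field_simp
      linear_combination -a * this
    rw [← h3]
    linear_combination (bernoulliSeries ((((m + 1) * k % q : ℕ) : ℚ) / q) a * (w - 1)) * h1 +
      PowerSeries.C B * PowerSeries.X * expSeries ((((k : ℚ) / q : ℚ) : K) * B) * h2
  have e2 : ∀ k ∈ range (m + 1), bernoulliSeries ((k : ℚ) / (m + 1 : ℕ)) B *
      bernoulliSeries (((q * k % (m + 1) : ℕ) : ℚ) / (m + 1 : ℕ)) (-M) *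
        ((expSeries B - 1) * (u - 1)) =
      PowerSeries.C B * PowerSeries.C M * PowerSeries.X ^ 2 *
        (v ^ k * u ^ (q * k / (m + 1) + 1)) := by
    intro k _
    have h1 := bernoulliSeries_mul ((k : ℚ) / (m + 1 : ℕ)) B
    have h2 := bernoulliSeries_neg_mul (((q * k % (m + 1) : ℕ) : ℚ) / (m + 1 : ℕ)) M
    -- Here (k/p)B + (1 - {qk/p})M = -ka + (⌊qk/p⌋ + 1)M; the reflected series at -M supplies the
    -- extra 1.
    have h3 : expSeries ((((k : ℚ) / (m + 1 : ℕ) : ℚ) : K) * B) *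
        expSeries ((1 - ((((q * k % (m + 1) : ℕ) : ℚ) / (m + 1 : ℕ) : ℚ) : K)) * M) =
        v ^ k * u ^ (q * k / (m + 1) + 1) := by
      rw [← expSeries_add, hu, hv, ← expSeries_nat_mul, ← expSeries_nat_mul, ← expSeries_add]
      congr 1
      have := hdm (q * k) (m + 1)
      rw [h]
      push_cast at this ⊢
      field_simp
      linear_combination M * this
    rw [← h3]
    linear_combination
      (bernoulliSeries (((q * k % (m + 1) : ℕ) : ℚ) / (m + 1 : ℕ)) (-M) * (u - 1)) * h1 +
      PowerSeries.C B * PowerSeries.X * expSeries ((((k : ℚ) / (m + 1 : ℕ) : ℚ) : K) * B) * h2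
  have s1 := sum_congr rfl e1
  have s2 := sum_congr rfl e2
  rw [← sum_mul, ← mul_sum] at s1 s2
  -- The staircase has only p - 1 rows; the term k = 0 is the additional u.
  have hS2 : ∑ k ∈ range (m + 1), v ^ k * u ^ (q * k / (m + 1) + 1) =
      u + v * ∑ j ∈ range m, v ^ j * u ^ (q * (j + 1) / (m + 1) + 1) := by
    rw [sum_range_succ', mul_sum, add_comm]
    congr 1
    · simp
    · exact sum_congr rfl fun _ _ => by ring
  rw [hS2] at s2
  have hM0 := bernoulliSeries_mul 0 M
  have ha0 := bernoulliSeries_mul 0 a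
  have hB0 := bernoulliSeries_mul 0 B
  rw [Rat.cast_zero, zero_mul, expSeries_zero, mul_one] at hM0 ha0 hB0
  have hW : (expSeries B - 1) * (w - 1) * (u - 1) ≠ 0 :=
    mul_ne_zero (mul_ne_zero (expSeries_sub_one_ne_zero hB) (expSeries_sub_one_ne_zero ha))
      (expSeries_sub_one_ne_zero hM)
  apply mul_right_cancel₀ hW
  generalize (∑ k ∈ range q, bernoulliSeries ((k : ℚ) / q) B *
    bernoulliSeries ((((m + 1) * k % q : ℕ) : ℚ) / q) a) = T1 at *
  generalize (∑ k ∈ range (m + 1), bernoulliSeries ((k : ℚ) / (m + 1 : ℕ)) B *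
      bernoulliSeries (((q * k % (m + 1) : ℕ) : ℚ) / (m + 1 : ℕ)) (-M)) = T2 at *
  generalize (∑ k ∈ range q, u ^ k * v ^ ((m + 1) * k / q)) = S1 at *
  generalize (∑ j ∈ range m, v ^ j * u ^ (q * (j + 1) / (m + 1) + 1)) = S2 at *
  rw [← hu] at hM0
  rw [← hw] at ha0
  have key : (u - 1) * S1 - (w - 1) * (u + v * S2) =
      (expSeries B - 1) + (w - 1) * (expSeries B - u) := by
    rw [heB]
    linear_combination hst - (S2 + u ^ q * v ^ m) * hvw
  generalize expSeries B = b at *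
  generalize PowerSeries.C B = cB at *
  generalize PowerSeries.C M = cM at *
  generalize PowerSeries.C a = ca at *
  generalize bernoulliSeries 0 M = EM at *
  generalize bernoulliSeries 0 B = EB at *
  generalize bernoulliSeries 0 a = Ea at *
  generalize (PowerSeries.X : PowerSeries K) = t at *
  clear_value u v w
  linear_combination cM * (u - 1) * s1 - ca * (w - 1) * s2 + cB * cM * ca * t ^ 2 * key -
    cB * (b - 1) * (w - 1) * Ea * hM0 - cB * (b - 1) * cM * t * ha0 -
    ca * t * (cB * (b - 1) * (w - 1) * hM0 - cM * (w - 1) * (u - 1) * hB0)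

/-! ### Reciprocity in a fixed even degree -/

/-- The generalized Dedekind sum with the Bernoulli polynomial value `B₁(0) = -1/2` at the
integers. -/
noncomputable def bernoulliSum (e f p q : ℕ) : ℚ :=
  ∑ k ∈ range q, (Polynomial.bernoulli e).eval ((k : ℚ) / q) *
    (Polynomial.bernoulli f).eval (((p * k % q : ℕ) : ℚ) / q)

theorem bernoulliSum_add_mul (e f p q c : ℕ) :
    bernoulliSum e f (c * q + p) q = bernoulliSum e f p q := by
  refine sum_congr rfl fun k _ => ?_
  rw [show (c * q + p) * k = p * k + q * (c * k) by ring, Nat.add_mul_mod_self_left]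

theorem bernoulliSum_zero_one (e f : ℕ) :
    bernoulliSum e f 0 1 = bernoulli e * bernoulli f := by
  simp [bernoulliSum, Polynomial.bernoulli_eval_zero]

/-- The part of degree `N - 2` of the generating function of `bernoulliSum e f p q / (e! f!)`,
evaluated at `(B, -A)`. -/
noncomputable def sumForm (N p q : ℕ) (A B : ℚ) : ℚ :=
  (∑ x ∈ antidiagonal N, bernoulliSum x.1 x.2 p q / (x.1.factorial * x.2.factorial) *
    (B ^ x.1 * (-A) ^ x.2)) / (B * -A)

theorem sumForm_add_mul (N p q c : ℕ) (A B : ℚ) :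
    sumForm N (c * q + p) q A B = sumForm N p q A B := by
  simp_rw [sumForm, bernoulliSum_add_mul]

theorem coeff_bernoulliSeries (s z : ℚ) (n : ℕ) :
    PowerSeries.coeff n (bernoulliSeries s z) =
      (Polynomial.bernoulli n).eval s / n.factorial * z ^ n := by
  simp [bernoulliSeries]

theorem coeff_sum_bernoulliSeries (N p q : ℕ) (A B : ℚ) :
    PowerSeries.coeff N (∑ k ∈ range q, bernoulliSeries ((k : ℚ) / q) B *
      bernoulliSeries (((p * k % q : ℕ) : ℚ) / q) A) =
    ∑ x ∈ antidiagonal N, bernoulliSum x.1 x.2 p q / (x.1.factorial * x.2.factorial) *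
      (B ^ x.1 * A ^ x.2) := by
  simp_rw [map_sum, PowerSeries.coeff_mul, coeff_bernoulliSeries]
  rw [sum_comm]
  refine sum_congr rfl fun x _ => ?_
  rw [bernoulliSum, sum_div, sum_mul]
  refine sum_congr rfl fun k _ => ?_
  field_simp

/-- This is the coefficient of t^N in `bernoulliSeries_reciprocity` at a = -A, divided by the
product of the three linear forms up to sign. Evenness of N removes the correction term. -/
theorem sumForm_reciprocity {N p q : ℕ} (hN : Even N) (hN0 : 0 < N) (hp : 0 < p) (hq : 0 < q)
    (hcop : Nat.Coprime p q) {A M B : ℚ} (hA : A ≠ 0) (hM : M ≠ 0) (hB : B ≠ 0)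
    (h : B = q * M + p * A) :
    sumForm N p q A B + sumForm N q p M B = sumForm N 0 1 A M := by
  have hrec := congrArg (PowerSeries.coeff N)
    (bernoulliSeries_reciprocity hp hq hcop hM (neg_ne_zero.mpr hA) hB
      (show B = q * M - p * -A by rw [h]; ring))
  have h0 : bernoulliSeries (0 : ℚ) M * bernoulliSeries 0 (-A) =
      ∑ k ∈ range 1, bernoulliSeries ((k : ℚ) / (1 : ℕ)) M *
        bernoulliSeries (((0 * k % 1 : ℕ) : ℚ) / (1 : ℕ)) (-A) := by simp
  obtain ⟨m, rfl⟩ : ∃ m, N = m + 1 := ⟨N - 1, by omega⟩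
  -- The correction involves only B_{N-1}, of odd index. It vanishes for N > 2, and for N = 2 its
  -- factor is B·M - M·B.
  have hzero : PowerSeries.coeff (m + 1) (PowerSeries.C (-A) * PowerSeries.X *
      (PowerSeries.C B * bernoulliSeries 0 M - PowerSeries.C M * bernoulliSeries 0 B)) = 0 := by
    rw [mul_assoc, PowerSeries.coeff_C_mul, PowerSeries.coeff_succ_X_mul, map_sub,
      PowerSeries.coeff_C_mul, PowerSeries.coeff_C_mul, coeff_bernoulliSeries,
      coeff_bernoulliSeries, Polynomial.bernoulli_eval_zero]
    have hodd : Odd m := by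
      rcases Nat.even_or_odd m with h | h
      · exact absurd hN (Nat.not_even_iff_odd.mpr h.add_one)
      · exact h
    rcases eq_or_ne m 1 with rfl | hm
    · ring
    · have hm1 : 1 < m := by rcases hodd with ⟨t, rfl⟩; omega
      rw [bernoulli_eq_zero_of_odd hodd hm1]; ring
  rw [map_add, hzero, add_zero, h0, map_sub, PowerSeries.coeff_C_mul, PowerSeries.coeff_C_mul,
    PowerSeries.coeff_C_mul, coeff_sum_bernoulliSeries, coeff_sum_bernoulliSeries,
    coeff_sum_bernoulliSeries] at hrec
  rw [sumForm, sumForm, sumForm]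
  generalize (∑ x ∈ antidiagonal (m + 1), bernoulliSum x.1 x.2 p q /
    (x.1.factorial * x.2.factorial) * (B ^ x.1 * (-A) ^ x.2)) = S1 at *
  generalize (∑ x ∈ antidiagonal (m + 1), bernoulliSum x.1 x.2 q p /
    (x.1.factorial * x.2.factorial) * (B ^ x.1 * (-M) ^ x.2)) = S2 at *
  generalize (∑ x ∈ antidiagonal (m + 1), bernoulliSum x.1 x.2 0 1 /
    (x.1.factorial * x.2.factorial) * (M ^ x.1 * (-A) ^ x.2)) = S3 at *
  clear h
  field_simp
  linear_combination -hrec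

/-! ### Iteration along the continued fraction -/

/-- Numerators of the convergents of `[c 0, c 1, …]`, with index shifted by one:
`contNum c (k + 1)` belongs to `[c 0, …, c (k - 1)]`. -/
def contNum (c : ℕ → ℕ) : ℕ → ℕ
  | 0 => 0
  | 1 => 1
  | k + 2 => c k * contNum c (k + 1) + contNum c k

/-- Denominators of the convergents, indexed as `contNum`. -/
def contDen (c : ℕ → ℕ) : ℕ → ℕ
  | 0 => 1
  | 1 => 0
  | k + 2 => c k * contDen c (k + 1) + contDen c k

/-- Dropping the first partial quotient is one step of Euclid's algorithm. The defining recursion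
adds quotients at the other end, whereas iterating reciprocity needs this one. -/
theorem contNum_contDen_succ (c : ℕ → ℕ) (k : ℕ) :
    contNum c (k + 1) = c 0 * contNum (fun i => c (i + 1)) k + contDen (fun i => c (i + 1)) k ∧
      contDen c (k + 1) = contNum (fun i => c (i + 1)) k := by
  induction k using Nat.twoStepInduction with
  | zero => simp [contNum, contDen]
  | one => simp [contNum, contDen]
  | more k h1 h2 =>
    have e1 : contNum c (k + 2 + 1) = c (k + 1) * contNum c (k + 2) + contNum c (k + 1) := rfl
    have e2 : contDen c (k + 2 + 1) = c (k + 1) * contDen c (k + 2) + contDen c (k + 1) := rfl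
    rw [e1, e2, h1.1, h1.2, h2.1, h2.2, contNum, contDen]
    exact ⟨by ring, rfl⟩

theorem contNum_pos (c : ℕ → ℕ) (n : ℕ) (hc : ∀ k < n, 1 ≤ c k) : 0 < contNum c (n + 1) := by
  induction n generalizing c with
  | zero => simp [contNum]
  | succ n ih =>
    rw [(contNum_contDen_succ c (n + 1)).1]
    have := ih (fun i => c (i + 1)) fun k hk => hc _ (by omega)
    have := Nat.mul_pos (hc 0 (by omega)) this
    omega

theorem contDen_pos (c : ℕ → ℕ) (n : ℕ) (hc : ∀ k < n + 1, 1 ≤ c k) :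
    0 < contDen c (n + 2) := by
  rw [(contNum_contDen_succ c (n + 1)).2]
  exact contNum_pos _ _ fun k hk => hc _ (by omega)

theorem coprime_contDen_contNum (c : ℕ → ℕ) (n : ℕ) :
    Nat.Coprime (contDen c n) (contNum c n) := by
  induction n generalizing c with
  | zero => simp [contNum, contDen]
  | succ n ih =>
    rw [(contNum_contDen_succ c n).1, (contNum_contDen_succ c n).2, Nat.coprime_mul_right_add_right]
    exact (ih _).symm

/-- Numerators and denominators are the two basic solutions of the recursion. The resulting formula
for the last term is the relation B = qM + pA that reciprocity requires. -/
theorem linearRec_eq (c : ℕ → ℕ) (l : ℕ → ℚ)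
    (hl : ∀ k, l (k + 2) = c k * l (k + 1) + l k) (k : ℕ) :
    l k = contNum c k * l 1 + contDen c k * l 0 := by
  induction k using Nat.twoStepInduction with
  | zero => simp [contNum, contDen]
  | one => simp [contNum, contDen]
  | more k h1 h2 =>
    rw [hl, h1, h2, contNum, contDen]; push_cast; ring

/-- Iterating the reciprocity law along a continued fraction. -/
theorem sumForm_contFrac {N : ℕ} (hN : Even N) (hN0 : 0 < N) (n : ℕ) (c : ℕ → ℕ)
    (hc : ∀ k < n, 1 ≤ c k) (l : ℕ → ℚ) (hl : ∀ k, l (k + 2) = c k * l (k + 1) + l k)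
    (hl0 : ∀ k ≤ n + 1, l k ≠ 0) :
    sumForm N (contDen c (n + 1)) (contNum c (n + 1)) (l 0) (l (n + 1)) =
      ∑ k ∈ range (n + 1), (-1) ^ k * sumForm N 0 1 (l k) (l (k + 1)) := by
  induction n generalizing c l with
  | zero => simp [contNum, contDen]
  | succ n ih =>
    have ih' := ih (fun i => c (i + 1)) (fun k hk => hc _ (by omega)) (fun i => l (i + 1))
      (fun k => hl (k + 1)) (fun k hk => hl0 _ (by omega))
    have hrec := sumForm_reciprocity hN hN0 (contDen_pos c n hc) (contNum_pos c (n + 1) hc)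
      (coprime_contDen_contNum c (n + 2)) (hl0 0 (by omega)) (hl0 1 (by omega))
      (hl0 (n + 2) le_rfl) (linearRec_eq c l hl (n + 2))
    have e1 := contNum_contDen_succ c (n + 1)
    have h2 : sumForm N (contNum c (n + 2)) (contDen c (n + 2)) (l 1) (l (n + 2)) =
        sumForm N (contDen (fun i => c (i + 1)) (n + 1)) (contNum (fun i => c (i + 1)) (n + 1))
          (l 1) (l (n + 2)) := by
      rw [e1.1, e1.2, sumForm_add_mul]
    rw [h2] at hrec
    rw [sum_range_succ', pow_zero, one_mul, ← hrec]
    simp_rw [pow_succ, mul_neg_one, neg_mul]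
    rw [sum_neg_distrib, ← ih', zero_add]
    ring

/-! ### Separation and cancellation of the poles -/

/-- The part of `sumForm N 0 1 A B` without poles. -/
noncomputable def regularForm (N : ℕ) (A B : ℚ) : ℚ :=
  ∑ i ∈ range (N - 1), (-1) ^ i * (bernoulli (i + 1) / (i + 1).factorial) *
    (bernoulli (N - 1 - i) / (N - 1 - i).factorial) * (B ^ i * A ^ (N - 2 - i))

/-- Only the two extreme terms of the antidiagonal, those containing B_0 = 1, fail to be divisible
by AB; they are the polar part. -/
theorem sumForm_zero_one {N : ℕ} (hN : Even N) (hN0 : 0 < N) {A B : ℚ} (hA : A ≠ 0)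
    (hB : B ≠ 0) :
    sumForm N 0 1 A B = regularForm N A B -
      bernoulli N / N.factorial * (A ^ (N - 1) / B + B ^ (N - 1) / A) := by
  obtain ⟨m, rfl⟩ : ∃ m, N = m + 2 := ⟨N - 2, by rcases hN with ⟨t, rfl⟩; omega⟩
  have hm : Even m := by
    rw [Nat.even_add] at hN; exact hN.mpr even_two
  rw [sumForm, Nat.sum_antidiagonal_eq_sum_range_succ_mk, sum_range_succ, sum_range_succ',
    regularForm]
  simp only [bernoulliSum_zero_one, Nat.sub_self, Nat.sub_zero, pow_zero, bernoulli_zero,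
    Nat.factorial_zero, hN.neg_pow, Nat.add_sub_cancel, show m + 2 - 1 = m + 1 from rfl]
  rw [add_div, add_div, sum_div]
  have : ∀ i ∈ range (m + 1), bernoulli (i + 1) * bernoulli (m + 2 - (i + 1)) /
      (((i + 1).factorial : ℚ) * (m + 2 - (i + 1)).factorial) *
        (B ^ (i + 1) * (-A) ^ (m + 2 - (i + 1))) / (B * -A) =
      (-1) ^ i * (bernoulli (i + 1) / (i + 1).factorial) *
        (bernoulli (m + 1 - i) / (m + 1 - i).factorial) * (B ^ i * A ^ (m - i)) := by
    intro i hi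
    rw [mem_range] at hi
    obtain ⟨j, rfl⟩ : ∃ j, m = i + j := ⟨m - i, by omega⟩
    have hs : ((-1 : ℚ)) ^ i = (-1) ^ j := by
      have := hm.neg_one_pow (α := ℚ)
      rw [pow_add] at this
      have h2 : ((-1 : ℚ) ^ j) * (-1) ^ j = 1 := by rw [← mul_pow]; simp
      linear_combination (-1) ^ j * this - (-1) ^ i * h2
    rw [show i + j + 2 - (i + 1) = j + 1 by omega, show i + j + 1 - i = j + 1 by omega,
      show i + j - i = j by omega, hs, neg_pow A]
    field_simp
    ring
  rw [sum_congr rfl this]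
  field_simp
  ring

/-- The pole-free combination of the polar parts of `sumForm` at an interior ray. -/
theorem alternating_sumForm {N : ℕ} (hN : Even N) (hN0 : 0 < N) (n : ℕ) (c : ℕ → ℕ)
    (l : ℕ → ℚ) (hl : ∀ k, l (k + 2) = c k * l (k + 1) + l k) (hl0 : ∀ k ≤ n + 1, l k ≠ 0) :
    ∑ k ∈ range (n + 1), (-1) ^ k * sumForm N 0 1 (l k) (l (k + 1)) =
      ∑ k ∈ range (n + 1), (-1) ^ k * regularForm N (l k) (l (k + 1)) +
      bernoulli N / N.factorial * ∑ k ∈ range n, (-1) ^ k * (c k) *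
        ∑ i ∈ range (N - 1), l (k + 2) ^ i * l k ^ (N - 2 - i) -
      bernoulli N / N.factorial *
        (l 1 ^ (N - 1) / l 0 + (-1) ^ n * (l n ^ (N - 1) / l (n + 1))) := by
  induction n with
  | zero =>
    simp only [zero_add, sum_range_one, pow_zero, one_mul, range_zero, sum_empty, mul_zero]
    rw [sumForm_zero_one hN hN0 (hl0 0 (by omega)) (hl0 1 (by omega))]
    ring
  | succ n ih =>
    rw [sum_range_succ, ih fun k hk => hl0 k (by omega), sum_range_succ _ (n + 1),
      sum_range_succ (fun k => (-1) ^ k * (c k : ℚ) *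
        ∑ i ∈ range (N - 1), l (k + 2) ^ i * l k ^ (N - 2 - i)) n, sumForm_zero_one hN hN0 (hl0 _ (by omega)) (hl0 _ (by omega))]
    -- Consecutive summands contribute poles along l (n + 1) with opposite signs. Their numerators
    -- differ by a multiple of l (n + 2) - l n = c n * l (n + 1), so the pole cancels.
    have hgeom := (Commute.all (l (n + 2)) (l n)).geom_sum₂_mul (N - 1)
    have hsub : l (n + 2) - l n = c n * l (n + 1) := by rw [hl]; ring
    rw [hsub, show N - 1 - 1 = N - 2 by omega] at hgeom
    have h1 := hl0 (n + 1) (by omega)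
    have hg : c n * ∑ i ∈ range (N - 1), l (n + 2) ^ i * l n ^ (N - 2 - i) =
        (l (n + 2) ^ (N - 1) - l n ^ (N - 1)) / l (n + 1) := by
      rw [eq_div_iff h1, ← hgeom]
      simp only [Nat.sub_right_comm]
      ring
    rw [mul_add, mul_assoc _ (c n : ℚ), hg]
    ring

/-! ### Specialization to linear polynomials and comparison of coefficients -/

theorem coeff_linear_pow (s t : ℚ) (m j : ℕ) :
    ((Polynomial.C s * Polynomial.X + Polynomial.C t) ^ m).coeff j =
      m.choose j * s ^ j * t ^ (m - j) := by
  have : (Polynomial.C s * Polynomial.X + Polynomial.C t) ^ m =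
      ∑ i ∈ range (m + 1), Polynomial.C (s ^ i * t ^ (m - i) * m.choose i) * Polynomial.X ^ i := by
    rw [add_pow]
    refine sum_congr rfl fun i _ => ?_
    simp only [map_mul, map_pow, map_natCast]
    ring
  rw [this, Polynomial.finsetSum_coeff]
  simp_rw [Polynomial.coeff_C_mul_X_pow]
  rw [sum_ite_eq]
  split_ifs with h
  · ring
  · rw [Nat.choose_eq_zero_of_lt (by simpa using h)]; simp

/-- Taking α and β factors X from the two powers produces C(i,α) C(m-i,β). These binomials vanish
outside α ≤ i ≤ m - β, which explains the summation range, and their factorials are those in f_k and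
g_k. -/
theorem coeff_weighted_linear_pow (w : ℕ → ℚ) (s t s' t' : ℚ) (m E : ℕ) (hE : E ≤ m) :
    ∑ x ∈ antidiagonal E, s ^ x.2 * s' ^ x.1 / (x.1.factorial * x.2.factorial) *
      ∑ i ∈ Icc x.1 (m - x.2), w i * ((m - i).factorial / (m - i - x.2).factorial) *
        (i.factorial / (i - x.1).factorial) * t ^ (m - i - x.2) * t' ^ (i - x.1) =
    (∑ i ∈ range (m + 1), Polynomial.C (w i) *
      ((Polynomial.C s' * Polynomial.X + Polynomial.C t') ^ i *
        (Polynomial.C s * Polynomial.X + Polynomial.C t) ^ (m - i))).coeff E := by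
  simp_rw [Polynomial.finsetSum_coeff, Polynomial.coeff_C_mul, Polynomial.coeff_mul,
    coeff_linear_pow]
  simp_rw [mul_sum]
  rw [sum_comm (s := range (m + 1))]
  refine sum_congr rfl fun x hx => ?_
  rw [HasAntidiagonal.mem_antidiagonal] at hx
  have hsub : Icc x.1 (m - x.2) ⊆ range (m + 1) := fun i hi => by
    rw [mem_Icc] at hi; rw [mem_range]; omega
  rw [← sum_subset hsub]
  · refine sum_congr rfl fun i hi => ?_
    rw [mem_Icc] at hi
    rw [Nat.cast_choose ℚ hi.1, Nat.cast_choose ℚ (show x.2 ≤ m - i by omega)]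
    field_simp
  · intro i hi hi'
    rw [mem_range] at hi
    rw [mem_Icc, not_and_or, not_le, not_le] at hi'
    rcases hi' with h | h
    · rw [Nat.choose_eq_zero_of_lt h]; simp
    · rw [Nat.choose_eq_zero_of_lt (show m - i < x.2 by omega)]; simp

/-- The linear polynomial `q_k X + D_k`, with the index of `contNum`. -/
noncomputable def rayPoly (c : ℕ → ℕ) (p q k : ℕ) : Polynomial ℚ :=
  Polynomial.C (contNum c k : ℚ) * Polynomial.X +
    Polynomial.C ((p : ℚ) * contNum c k - q * contDen c k)

/-- The determinant of two consecutive convergents. It shows that the constant term of the last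
interior ray polynomial is a sign. -/
theorem contNum_mul_sub (c : ℕ → ℕ) (n : ℕ) :
    (contDen c (n + 1) : ℚ) * contNum c n - contNum c (n + 1) * contDen c n = (-1) ^ (n + 1) := by
  induction n with
  | zero => simp [contNum, contDen]
  | succ n ih =>
    rw [contNum, contDen, pow_succ, ← ih]; push_cast; ring

/-- The regular part of the generating function attached to a continued fraction. -/
noncomputable def regularPoly (c : ℕ → ℕ) (p q n m : ℕ) : Polynomial ℚ :=
  ∑ k ∈ range (n + 1), Polynomial.C ((-1) ^ k) * (∑ i ∈ range (m + 1),
      Polynomial.C ((-1) ^ i * (bernoulli (i + 1) / (i + 1).factorial) *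
        (bernoulli (m + 1 - i) / (m + 1 - i).factorial)) *
        (rayPoly c p q (k + 1) ^ i * rayPoly c p q k ^ (m - i))) +
    Polynomial.C (bernoulli (m + 2) / (m + 2).factorial) *
      ∑ k ∈ range n, Polynomial.C ((-1) ^ k * (c k : ℚ)) * (∑ i ∈ range (m + 1),
        Polynomial.C 1 * (rayPoly c p q (k + 2) ^ i * rayPoly c p q k ^ (m - i)))

/-- With A = -q and B = qx, every term of the form carries the same power q^N, and multiplying by
B·(-A) = q²x clears the two surviving poles. -/
theorem bernoulliSum_polynomial {m : ℕ} (hm : Even m) (n : ℕ) (c : ℕ → ℕ)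
    (hc : ∀ k < n + 1, 1 ≤ c k) {p q : ℕ} (hp : contDen c (n + 2) = p)
    (hq : contNum c (n + 2) = q) :
    ∑ x ∈ antidiagonal (m + 2), Polynomial.C (bernoulliSum x.1 x.2 p q /
        (x.1.factorial * x.2.factorial) * q ^ (m + 2)) * Polynomial.X ^ x.1 =
      Polynomial.X * (Polynomial.C (q ^ 2 : ℚ) * regularPoly c p q (n + 1) m) +
      Polynomial.C (q * (bernoulli (m + 2) / (m + 2).factorial) : ℚ) *
        (Polynomial.X * rayPoly c p q 1 ^ (m + 1) +
          Polynomial.C ((-1) ^ n) * rayPoly c p q (n + 1) ^ (m + 1)) := by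
  refine Polynomial.eq_of_infinite_eval_eq _ _ (Set.infinite_of_forall_exists_gt fun y => ?_)
  -- For x > q one has l 2 = c 0 * (x + p) - q > 0, and the recursion keeps all later l k positive,
  -- so no denominator vanishes.
  refine ⟨max y q + 1, ?_, by linarith [le_max_left y (q : ℚ)]⟩
  have hx : (q : ℚ) < max y q + 1 := by linarith [le_max_right y (q : ℚ)]
  generalize max y q + 1 = x at hx
  have hq0 : 0 < q := hq ▸ contNum_pos c (n + 1) hc
  have hqQ : (0 : ℚ) < q := by exact_mod_cast hq0
  have hx0 : 0 < x := hqQ.trans hx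
  set l : ℕ → ℚ := fun k => (rayPoly c p q k).eval x with hl_def
  have hl_apply : ∀ k, l k = contNum c k * x + (p * contNum c k - q * contDen c k) := fun k => by
    simp [hl_def, rayPoly]
  have hl : ∀ k, l (k + 2) = c k * l (k + 1) + l k := fun k => by
    simp only [hl_apply, contNum, contDen]; push_cast; ring
  have l0 : l 0 = -q := by simp [hl_apply, contNum, contDen]
  have l1 : l 1 = x + p := by simp [hl_apply, contNum, contDen]
  have llast : l (n + 2) = q * x := by rw [hl_apply, hp, hq]; ring
  have hpos : ∀ k, 0 < l (k + 1) := by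
    intro k
    induction k using Nat.twoStepInduction with
    | zero => rw [l1]; positivity
    | one =>
      rw [hl, l0, l1]
      have : (1 : ℚ) ≤ c 0 := by exact_mod_cast hc 0 (by omega)
      have hxp : 0 < x + p := by positivity
      have := mul_le_mul_of_nonneg_right this hxp.le
      have : (0 : ℚ) ≤ p := by positivity
      linarith
    | more k h1 h2 => rw [hl]; positivity
  have hl0 : ∀ k ≤ n + 1 + 1, l k ≠ 0 := by
    intro k _
    cases k with
    | zero => rw [l0]; exact neg_ne_zero.mpr hqQ.ne'
    | succ k => exact (hpos k).ne'
  have hN : Even (m + 2) := hm.add even_two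
  have h1 := sumForm_contFrac hN (by omega) (n + 1) c hc l hl hl0
  rw [alternating_sumForm hN (by omega) (n + 1) c l hl hl0, hp, hq, l0, l1, llast, sumForm,
    neg_neg, div_eq_iff (by positivity)] at h1
  have h2 : ∑ z ∈ antidiagonal (m + 2), bernoulliSum z.1 z.2 p q /
      (z.1.factorial * z.2.factorial) * (((q : ℚ) * x) ^ z.1 * (q : ℚ) ^ z.2) =
      ∑ z ∈ antidiagonal (m + 2), bernoulliSum z.1 z.2 p q /
      (z.1.factorial * z.2.factorial) * (q : ℚ) ^ (m + 2) * x ^ z.1 :=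
    sum_congr rfl fun z hz => by
      rw [← HasAntidiagonal.mem_antidiagonal.mp hz]; ring
  have hreg : (regularPoly c p q (n + 1) m).eval x =
      ∑ k ∈ range (n + 1 + 1), (-1) ^ k * regularForm (m + 2) (l k) (l (k + 1)) +
      bernoulli (m + 2) / (m + 2).factorial * ∑ k ∈ range (n + 1), (-1) ^ k * (c k) *
        ∑ i ∈ range (m + 1), l (k + 2) ^ i * l k ^ (m - i) := by
    simp only [regularPoly, regularForm, Polynomial.eval_add, Polynomial.eval_mul,
      Polynomial.eval_C, Polynomial.eval_finsetSum, Polynomial.eval_pow, hl_def, one_mul,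
      Nat.add_sub_cancel, show m + 2 - 1 = m + 1 from rfl]
  rw [h2] at h1
  simp only [Set.mem_ofPred_eq, Polynomial.eval_add, Polynomial.eval_mul, Polynomial.eval_C,
    Polynomial.eval_finsetSum, Polynomial.eval_pow, Polynomial.eval_X]
  rw [h1, hreg, show Polynomial.eval x (rayPoly c p q 1) = x + p from l1,
    show Polynomial.eval x (rayPoly c p q (n + 1)) = l (n + 1) from rfl]
  simp only [Nat.add_sub_cancel, show m + 2 - 1 = m + 1 from rfl]
  field_simp
  ring

/-- The value of `bernoulliSum` in terms of the coefficients of `regularPoly`. -/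
theorem bernoulliSum_eq_coeff {e f : ℕ} (hN : Even (e + f)) (n : ℕ) (c : ℕ → ℕ)
    (hc : ∀ k < n + 1, 1 ≤ c k) {p q : ℕ} (hp : contDen c (n + 2) = p)
    (hq : contNum c (n + 2) = q) :
    bernoulliSum (e + 1) (f + 1) p q / ((e + 1).factorial * (f + 1).factorial) * q ^ (e + f + 1) =
      q * (regularPoly c p q (n + 1) (e + f)).coeff e +
      bernoulli (e + f + 2) / (e + f + 2).factorial * (e + f + 1).choose (f + 1) * p ^ (f + 1) +
      bernoulli (e + f + 2) / (e + f + 2).factorial * (e + f + 1).choose (e + 1) *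
        ((-1) ^ n * contNum c (n + 1)) ^ (e + 1) := by
  have hq0 : (q : ℚ) ≠ 0 := by exact_mod_cast (hq ▸ contNum_pos c (n + 1) hc).ne'
  have h := congrArg (fun P => Polynomial.coeff P (e + 1))
    (bernoulliSum_polynomial hN n c hc hp hq)
  simp only [Polynomial.finsetSum_coeff, Polynomial.coeff_X_pow, Polynomial.coeff_add,
    Polynomial.coeff_X_mul, Polynomial.coeff_C_mul] at h
  rw [sum_eq_single (e + 1, f + 1), if_pos rfl, mul_one] at h
  rotate_left
  · intro x hx hne
    rw [if_neg, mul_zero]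
    intro hx1
    rw [HasAntidiagonal.mem_antidiagonal] at hx
    exact hne (Prod.ext hx1.symm (by simp only; omega))
  · intro hx
    exact absurd (HasAntidiagonal.mem_antidiagonal.mpr (by simp only; omega)) hx
  rw [rayPoly, rayPoly, coeff_linear_pow, coeff_linear_pow] at h
  have hD := contNum_mul_sub c (n + 1)
  rw [hp, hq] at hD
  rw [hD, show e + f + 1 - e = f + 1 by omega, show e + f + 1 - (e + 1) = f by omega,
    ← Nat.choose_symm (show e ≤ e + f + 1 by omega), show e + f + 1 - e = f + 1 by omega] at h
  simp only [contNum, contDen] at h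
  -- Evenness of e + f allows the exponent f of the sign to be replaced by e; the outer factor
  -- (-1)^n then completes the power e + 1.
  have hs : ((-1 : ℚ) ^ (n + 1 + 1)) ^ f = ((-1) ^ n) ^ e := by
    rw [pow_succ, pow_succ, mul_assoc, neg_one_mul, neg_neg, mul_one, ← pow_mul, ← pow_mul]
    have h1 : ((-1 : ℚ) ^ (n * e)) * (-1) ^ (n * f) = 1 := by
      rw [← pow_add, ← mul_add, pow_mul', hN.neg_one_pow, one_pow]
    have h2 : ((-1 : ℚ) ^ (n * e)) * (-1) ^ (n * e) = 1 := by rw [← mul_pow]; simp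
    linear_combination (-1) ^ (n * e) * h1 - (-1) ^ (n * f) * h2
  rw [hs] at h
  apply mul_left_cancel₀ hq0
  push_cast at h
  linear_combination h

/-! ### Comparison with the convergents and sums of the statement -/

theorem contFrac_eq_div (c : ℕ → ℕ) (m : ℕ) (hc : ∀ k < m, 1 ≤ c k) :
    contFrac ((List.range m).map c) = (contNum c (m + 1) : ℚ) / contDen c (m + 1) := by
  induction m generalizing c with
  | zero => simp [contFrac, contDen]
  | succ m ih =>
    rw [List.range_succ_eq_map, List.map_cons, contFrac, List.map_map]
    have hc' : ∀ k < m, 1 ≤ c (k + 1) := fun k hk => hc _ (by omega)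
    have := ih (fun i => c (i + 1)) hc'
    rw [show (c ∘ Nat.succ) = fun i => c (i + 1) from rfl, this,
      (contNum_contDen_succ c (m + 1)).1, (contNum_contDen_succ c (m + 1)).2]
    have h0 : (contNum (fun i => c (i + 1)) (m + 1) : ℚ) ≠ 0 := by
      exact_mod_cast (contNum_pos _ m hc').ne'
    push_cast
    field_simp

theorem num_den_div {p q : ℕ} (hp : 0 < p) (hcop : Nat.Coprime p q) :
    ((q : ℚ) / p).num = q ∧ ((q : ℚ) / p).den = p := by
  have hp' : (0 : ℤ) < p := by exact_mod_cast hp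
  have h : Nat.Coprime (q : ℤ).natAbs (p : ℤ).natAbs := by simpa using hcop.symm
  have h1 := Rat.num_div_eq_of_coprime hp' h
  have h2 := Rat.den_div_eq_of_coprime hp' h
  push_cast at h1 h2
  exact ⟨h1, by exact_mod_cast h2⟩

theorem contFracTo_eq_div {a : ℕ → ℕ} {n : ℕ} (ha : ∀ k, 1 ≤ k → k ≤ n → 1 ≤ a k)
    {m : ℕ} (hm : m ≤ n) :
    contFracTo a m = (contNum (fun i => a (i + 1)) (m + 1) : ℚ) /
      contDen (fun i => a (i + 1)) (m + 1) :=
  contFrac_eq_div _ _ fun k hk => ha _ (by omega) (by omega)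

theorem contFracTo_num_den {a : ℕ → ℕ} {n : ℕ} (ha : ∀ k, 1 ≤ k → k ≤ n → 1 ≤ a k)
    {m : ℕ} (hm : m + 1 ≤ n) :
    (contFracTo a (m + 1)).num = contNum (fun i => a (i + 1)) (m + 2) ∧
      (contFracTo a (m + 1)).den = contDen (fun i => a (i + 1)) (m + 2) := by
  rw [contFracTo_eq_div ha hm]
  exact num_den_div (contDen_pos _ _ fun k hk => ha _ (by omega) (by omega))
    (coprime_contDen_contNum _ _)

theorem convQ_eq {a : ℕ → ℕ} {n : ℕ} (ha : ∀ k, 1 ≤ k → k ≤ n → 1 ≤ a k)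
    {j : ℕ} (hj : j ≤ n + 1) :
    convQ a ((j : ℤ) - 1) = contNum (fun i => a (i + 1)) j := by
  rcases j with _ | _ | m
  · simp [convQ, contNum]
  · simp [convQ, contNum]
  · rw [convQ, if_neg (by omega), if_neg (by omega),
      show (((m + 1 + 1 : ℕ) : ℤ) - 1).toNat = m + 1 by omega]
    exact (contFracTo_num_den ha (by omega)).1

theorem convP_eq {a : ℕ → ℕ} {n : ℕ} (ha : ∀ k, 1 ≤ k → k ≤ n → 1 ≤ a k)
    {j : ℕ} (hj : j ≤ n + 1) :
    convP a ((j : ℤ) - 1) = contDen (fun i => a (i + 1)) j := by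
  rcases j with _ | _ | m
  · simp [convP, contDen]
  · simp [convP, contDen]
  · rw [convP, if_neg (by omega), if_neg (by omega),
      show (((m + 1 + 1 : ℕ) : ℤ) - 1).toNat = m + 1 by omega]
    exact_mod_cast (contFracTo_num_den ha (by omega)).2

theorem convD_eq {a : ℕ → ℕ} {n : ℕ} (ha : ∀ k, 1 ≤ k → k ≤ n → 1 ≤ a k)
    (p q : ℕ) {j : ℕ} (hj : j ≤ n + 1) :
    (convD p q a ((j : ℤ) - 1) : ℚ) = p * contNum (fun i => a (i + 1)) j -
      q * contDen (fun i => a (i + 1)) j := by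
  rw [convD, convQ_eq ha hj, convP_eq ha hj]; push_cast; rfl

/-- The factors i! and (N-2-i)! from the binomials turn B_{i+1}/(i+1)! and B_{N-i-1}/(N-i-1)! into
the quotients B_{i+1}/(i+1) and B_{N-i-1}/(N-i-1) of f_k. -/
theorem sum_fTerm {a : ℕ → ℕ} {n : ℕ} (ha : ∀ k, 1 ≤ k → k ≤ n → 1 ≤ a k)
    (p q m E : ℕ) (hE : E ≤ m) {j : ℕ} (hj : j ≤ n) :
    ∑ x ∈ antidiagonal E, fTerm p q a (m + 2) ((j : ℤ) - 1) x.1 x.2 =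
      (∑ i ∈ range (m + 1),
        Polynomial.C ((-1) ^ i * (bernoulli (i + 1) / (i + 1).factorial) *
          (bernoulli (m + 1 - i) / (m + 1 - i).factorial)) *
        (rayPoly (fun i => a (i + 1)) p q (j + 1) ^ i *
          rayPoly (fun i => a (i + 1)) p q j ^ (m - i))).coeff E := by
  simp only [rayPoly]
  rw [← coeff_weighted_linear_pow _ _ _ _ _ m E hE]
  refine sum_congr rfl fun x _ => ?_
  have hQ := convQ_eq ha (show j + 1 ≤ n + 1 by omega)
  have hD := convD_eq ha p q (show j + 1 ≤ n + 1 by omega)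
  rw [show ((j + 1 : ℕ) : ℤ) - 1 = (j : ℤ) - 1 + 1 by push_cast; ring] at hQ hD
  rw [fTerm, hQ, hD, convQ_eq ha (by omega), convD_eq ha p q (by omega), Nat.add_sub_cancel]
  push_cast
  congr 1
  refine sum_congr rfl fun i hi => ?_
  rw [mem_Icc] at hi
  obtain ⟨r, hr⟩ : ∃ r, m - i = r := ⟨_, rfl⟩
  rw [show m + 2 - i - 1 = r + 1 by omega, show m + 1 - i = r + 1 by omega, hr,
    Nat.factorial_succ, Nat.factorial_succ]
  push_cast
  field_simp

theorem sum_gTerm {a : ℕ → ℕ} {n : ℕ} (ha : ∀ k, 1 ≤ k → k ≤ n → 1 ≤ a k)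
    (p q m E : ℕ) (hE : E ≤ m) {k : ℕ} (hk : k < n) :
    ∑ x ∈ antidiagonal E, gTerm p q a (m + 2) k x.1 x.2 =
      (∑ i ∈ range (m + 1), Polynomial.C 1 *
        (rayPoly (fun i => a (i + 1)) p q (k + 2) ^ i *
          rayPoly (fun i => a (i + 1)) p q k ^ (m - i))).coeff E := by
  simp only [rayPoly]
  rw [← coeff_weighted_linear_pow _ _ _ _ _ m E hE]
  refine sum_congr rfl fun x _ => ?_
  have hQ := convQ_eq ha (show k + 2 ≤ n + 1 by omega)
  have hD := convD_eq ha p q (show k + 2 ≤ n + 1 by omega)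
  rw [show ((k + 2 : ℕ) : ℤ) - 1 = (k : ℤ) + 1 by push_cast; ring] at hQ hD
  rw [gTerm, hQ, hD, convQ_eq ha (by omega), convD_eq ha p q (by omega), Nat.add_sub_cancel]
  push_cast
  congr 1
  refine sum_congr rfl fun i hi => ?_
  rw [show m + 2 - i - 2 = m - i by omega, one_mul]

theorem integralCoeff_eq {a : ℕ → ℕ} {n : ℕ} (ha : ∀ k, 1 ≤ k → k ≤ n → 1 ≤ a k)
    (e f p q : ℕ) :
    integralCoeff (e + 1) (f + 1) p q n a =
      (regularPoly (fun i => a (i + 1)) p q n (e + f)).coeff e := by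
  rw [integralCoeff, regularPoly, sum_add_distrib, sum_comm, ← mul_sum,
    sum_comm (t := range n), show e + 1 + (f + 1) = e + f + 2 by ring, Polynomial.coeff_add, Polynomial.coeff_C_mul,
    Polynomial.finsetSum_coeff, Polynomial.finsetSum_coeff, Nat.add_sub_cancel]
  congr 1
  · refine sum_congr rfl fun k hk => ?_
    rw [← mul_sum, sum_fTerm ha p q (e + f) e (by omega) (by rw [mem_range] at hk; omega),
      Polynomial.coeff_C_mul]
  · congr 1
    refine sum_congr rfl fun k hk => ?_
    rw [← mul_sum, sum_gTerm ha p q (e + f) e (by omega) (by rwa [mem_range] at hk),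
      Polynomial.coeff_C_mul]

theorem bernoulliSum_eq_integralCoeff {p q : ℕ} (hp : 0 < p) (hcop : Nat.Coprime p q)
    {n : ℕ} (hn : 1 ≤ n) {a : ℕ → ℕ} (ha : ∀ k, 1 ≤ k → k ≤ n → 1 ≤ a k)
    (hcf : contFracTo a n = (q : ℚ) / p) {e f : ℕ} (he : 0 < e) (hf : 0 < f)
    (hN : Even (e + f)) :
    bernoulliSum e f p q / (e.factorial * f.factorial) * q ^ (e + f - 1) =
      q * integralCoeff e f p q n a +
      bernoulli (e + f) / (e + f).factorial * (e + f - 1).choose f * p ^ f +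
      bernoulli (e + f) / (e + f).factorial * (e + f - 1).choose e *
        ((-1) ^ (n - 1) * (convQ a ((n : ℤ) - 1) : ℚ)) ^ e := by
  obtain ⟨e, rfl⟩ : ∃ e', e = e' + 1 := ⟨e - 1, by omega⟩
  obtain ⟨f, rfl⟩ : ∃ f', f = f' + 1 := ⟨f - 1, by omega⟩
  obtain ⟨n, rfl⟩ : ∃ n', n = n' + 1 := ⟨n - 1, by omega⟩
  rw [show e + 1 + (f + 1) = e + f + 2 by ring] at *
  have h1 := contFracTo_num_den ha le_rfl
  rw [hcf, (num_den_div hp hcop).1, (num_den_div hp hcop).2] at h1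
  have hef : Even (e + f) := by
    rw [Nat.even_add] at hN; exact hN.mpr even_two
  rw [integralCoeff_eq ha, convQ_eq ha (by omega)]
  exact_mod_cast bernoulliSum_eq_coeff hef n (fun i => a (i + 1))
    (fun k hk => ha _ (by omega) (by omega)) h1.2.symm (by exact_mod_cast h1.1.symm)

/-- By coprimality both arguments are non-integral for 0 < k < q. The conventions for B_1 at
integers therefore matter only at k = 0, where δ restores B_e B_f. -/
theorem dedekindSum_add_delta {p q : ℕ} (hq : 0 < q) (hcop : Nat.Coprime p q)
    {e f : ℕ} : dedekindSum e f p q + delta e f * bernoulli e * bernoulli f =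
      bernoulliSum e f p q := by
  obtain ⟨m, rfl⟩ : ∃ m, q = m + 1 := ⟨q - 1, by omega⟩
  rw [dedekindSum, bernoulliSum, sum_range_succ', sum_range_succ', add_assoc]
  congr 1
  · refine sum_congr rfl fun k hk => ?_
    rw [mem_range] at hk
    have h1 : Int.fract (((k + 1 : ℕ) : ℚ) / (m + 1 : ℕ)) = ((k + 1 : ℕ) : ℚ) / (m + 1 : ℕ) := by
      rw [Int.fract_div_natCast_eq_div_natCast_mod, Nat.mod_eq_of_lt (by omega)]
    have h2 : Int.fract ((p : ℚ) * (k + 1 : ℕ) / (m + 1 : ℕ)) =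
        ((p * (k + 1) % (m + 1) : ℕ) : ℚ) / (m + 1 : ℕ) := by
      rw [← Nat.cast_mul, Int.fract_div_natCast_eq_div_natCast_mod]
    have hm : ((m + 1 : ℕ) : ℚ) ≠ 0 := by positivity
    have h3 : ((p * (k + 1) % (m + 1) : ℕ) : ℚ) ≠ 0 := by
      intro h
      have hd : m + 1 ∣ k + 1 :=
        hcop.symm.dvd_of_dvd_mul_left (Nat.dvd_of_mod_eq_zero (by exact_mod_cast h))
      have := Nat.le_of_dvd (by omega) hd
      omega
    rw [periodicBernoulli, periodicBernoulli, h1, h2,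
      if_neg fun h => div_ne_zero (by positivity) hm h.2,
      if_neg fun h => div_ne_zero h3 hm h.2]
  · simp only [periodicBernoulli, delta, Nat.cast_zero, zero_div, mul_zero, Int.fract_zero,
      Nat.zero_mod, Polynomial.bernoulli_eval_zero, and_true]
    split_ifs <;> simp_all

/-! ### The Todd series as a sum over characters of a cyclic group -/

theorem toddFactor_eq_sum {q : ℕ} (hq : 0 < q) {c : ℂ} (hc : c ^ q = 1) :
    toddFactor c = PowerSeries.C (q : ℂ)⁻¹ *
      ∑ k ∈ range q, PowerSeries.C (c ^ k) * bernoulliSeries ((k : ℚ) / q) (-(q : ℂ)) := by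
  have hqC : (q : ℂ) ≠ 0 := by exact_mod_cast hq.ne'
  have hT := toddFactor_mul c
  set E := expSeries (-1 : ℂ) with hE
  rw [show PowerSeries.evalNegHom (PowerSeries.exp ℂ) = E from rfl] at hT
  have hEq : expSeries (-(q : ℂ)) = E ^ q := by
    rw [hE, ← expSeries_nat_mul]; congr 1; ring
  have hc0 : c ≠ 0 := by rintro rfl; simp [hq.ne'] at hc
  have h1 : 1 - PowerSeries.C c * E ≠ 0 := by
    intro h
    have := congrArg (PowerSeries.coeff 1) h
    simp [hE, expSeries, PowerSeries.coeff_rescale, PowerSeries.coeff_exp,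
      PowerSeries.coeff_one, hc0] at this
  have h2 : E ^ q - 1 ≠ 0 := hEq ▸ expSeries_sub_one_ne_zero (neg_ne_zero.mpr hqC)
  -- As c^q = 1, x/(1 - c e^{-x}) = x ∑ c^k e^{-kx} / (1 - e^{-qx}), and each summand is, up to 1/q,
  -- a Bernoulli series at k/q in the variable -qx. The case c = 1 needs no separate treatment.
  have hterm : ∀ k ∈ range q, PowerSeries.C (c ^ k) * bernoulliSeries ((k : ℚ) / q) (-(q : ℂ)) *
      (E ^ q - 1) = PowerSeries.C (-(q : ℂ)) * PowerSeries.X * (PowerSeries.C c * E) ^ k := by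
    intro k _
    have h := bernoulliSeries_mul ((k : ℚ) / q) (-(q : ℂ))
    rw [hEq, show (((k : ℚ) / q : ℚ) : ℂ) * -(q : ℂ) = k * (-1) by push_cast; field_simp,
      expSeries_nat_mul] at h
    rw [mul_assoc, h, mul_pow, map_pow]
    ring
  have hsum := sum_congr rfl hterm
  rw [← sum_mul, ← mul_sum] at hsum
  have hgeom := mul_neg_geom_sum (PowerSeries.C c * E) q
  rw [mul_pow, ← map_pow, hc, map_one, one_mul] at hgeom
  have hCq : PowerSeries.C (q : ℂ)⁻¹ * PowerSeries.C (-(q : ℂ)) = (-1 : PowerSeries ℂ) := by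
    rw [← map_mul, mul_neg, inv_mul_cancel₀ hqC, map_neg, map_one]
  apply mul_right_cancel₀ (mul_ne_zero h1 h2)
  linear_combination (E ^ q - 1) * hT -
    PowerSeries.C (q : ℂ)⁻¹ * (1 - PowerSeries.C c * E) * hsum - PowerSeries.X *
      (1 - PowerSeries.C c * E) * (∑ k ∈ range q, (PowerSeries.C c * E) ^ k) * hCq +
      PowerSeries.X * hgeom

theorem coeff_toddFactor {q : ℕ} (hq : 0 < q) {c : ℂ} (hc : c ^ q = 1) (n : ℕ) :
    PowerSeries.coeff n (toddFactor c) = (-(q : ℂ)) ^ n / (q * n.factorial) *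
      ∑ k ∈ range q, c ^ k * (((Polynomial.bernoulli n).eval ((k : ℚ) / q) : ℚ) : ℂ) := by
  rw [toddFactor_eq_sum hq hc, PowerSeries.coeff_C_mul, map_sum, mul_sum, mul_sum]
  refine sum_congr rfl fun k _ => ?_
  rw [PowerSeries.coeff_C_mul, bernoulliSeries, PowerSeries.coeff_mk]
  push_cast
  ring

theorem coeff_subst_X {σ : Type*} [DecidableEq σ] (s : σ) (A : PowerSeries ℂ) (u : σ →₀ ℕ) :
    MvPowerSeries.coeff u (A.subst (MvPowerSeries.X s : MvPowerSeries σ ℂ)) =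
      if u = Finsupp.single s (u s) then PowerSeries.coeff (u s) A else 0 := by
  rw [PowerSeries.coeff_subst (PowerSeries.HasSubst.X s), finsum_eq_single _ (u s)]
  · rw [MvPowerSeries.coeff_X_pow]; simp
  · intro d hd
    rw [MvPowerSeries.coeff_X_pow, if_neg, smul_zero]
    intro h
    apply hd
    rw [h]; simp

theorem coeff_subst_mul_subst (A B : PowerSeries ℂ) (e f : ℕ) :
    MvPowerSeries.coeff (Finsupp.single 0 e + Finsupp.single 1 f)
      (A.subst (MvPowerSeries.X 0 : MvPowerSeries (Fin 2) ℂ) *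
        B.subst (MvPowerSeries.X 1 : MvPowerSeries (Fin 2) ℂ)) =
      PowerSeries.coeff e A * PowerSeries.coeff f B := by
  rw [MvPowerSeries.coeff_mul, sum_eq_single (Finsupp.single 0 e, Finsupp.single 1 f)]
  · simp [coeff_subst_X]
  · rintro ⟨u, v⟩ huv hne
    rw [HasAntidiagonal.mem_antidiagonal] at huv
    simp only [coeff_subst_X]
    split_ifs with hu hv
    · refine absurd ?_ hne
      have h0 := DFunLike.congr_fun huv 0
      have h1 := DFunLike.congr_fun huv 1
      have hu1 := DFunLike.congr_fun hu 1
      have hv0 := DFunLike.congr_fun hv 0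
      simp at h0 h1 hu1 hv0
      rw [hv0, add_zero] at h0
      rw [hu1, zero_add] at h1
      rw [Prod.mk.injEq, hu, hv, h0, h1]
      exact ⟨rfl, rfl⟩
    all_goals simp
  · intro h
    rw [HasAntidiagonal.mem_antidiagonal] at h
    exact (h rfl).elim

/-- The second coordinate modulo `q`. -/
def heightMod (q : ℕ) : (Fin 2 → ℤ) →+ ZMod q :=
  (Int.castAddHom (ZMod q)).comp (Pi.evalAddMonoidHom (fun _ : Fin 2 => ℤ) 1)

theorem heightMod_apply (q : ℕ) (g : Fin 2 → ℤ) : heightMod q g = (g 1 : ZMod q) := rfl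

/-- Since (1,0) is one of the generators, the quotient sees only the second coordinate modulo q. -/
theorem coneLattice_eq_ker (p q : ℕ) :
    coneLattice ![1, 0] ![(p : ℤ), (q : ℤ)] = (heightMod q).ker := by
  apply le_antisymm
  · rw [coneLattice, AddSubgroup.closure_le]
    rintro v (rfl | rfl) <;> simp [AddMonoidHom.mem_ker, heightMod_apply]
  · intro v hv
    rw [AddMonoidHom.mem_ker, heightMod_apply, ZMod.intCast_zmod_eq_zero_iff_dvd] at hv
    obtain ⟨t, ht⟩ := hv
    have hv' : v = (v 0 - p * t) • ![1, 0] + t • ![(p : ℤ), (q : ℤ)] := by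
      ext i
      fin_cases i
      · simp; ring
      · simp [ht]; ring
    rw [hv', coneLattice]
    exact add_mem (zsmul_mem (AddSubgroup.subset_closure (by simp)) _)
      (zsmul_mem (AddSubgroup.subset_closure (by simp)) _)

theorem heightMod_surjective (q : ℕ) : Function.Surjective (heightMod q) := by
  intro y
  obtain ⟨t, rfl⟩ := ZMod.intCast_surjective y
  exact ⟨![0, t], by simp [heightMod_apply]⟩

/-- The group of the cone generated by `(1,0)` and `(p,q)` is cyclic of order `q`. -/
noncomputable def coneQuotientEquiv (p q : ℕ) :
    (Fin 2 → ℤ) ⧸ coneLattice ![1, 0] ![(p : ℤ), (q : ℤ)] ≃+ ZMod q :=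
  (QuotientAddGroup.quotientAddEquivOfEq (coneLattice_eq_ker p q)).trans
    (QuotientAddGroup.quotientKerEquivOfSurjective (heightMod q) (heightMod_surjective q))

theorem coneQuotientEquiv_apply (p q : ℕ)
    (γ : (Fin 2 → ℤ) ⧸ coneLattice ![1, 0] ![(p : ℤ), (q : ℤ)]) :
    coneQuotientEquiv p q γ = (γ.out 1 : ZMod q) := by
  conv_lhs => rw [← QuotientAddGroup.out_eq' γ]
  rfl

theorem coneCoord_eq {p q : ℕ} (hq : 0 < q) (g : Fin 2 → ℤ) :
    coneCoord ![1, 0] ![(p : ℤ), (q : ℤ)] g = ![(g 0 : ℚ) - p * g 1 / q, (g 1 : ℚ) / q] := by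
  have hq' : (q : ℚ) ≠ 0 := by exact_mod_cast hq.ne'
  have hM : coneMatrix ![1, 0] ![(p : ℤ), (q : ℤ)] = !![1, (p : ℚ); 0, (q : ℚ)] := by
    ext i j
    fin_cases i <;> fin_cases j <;> simp [coneMatrix]
  rw [coneCoord, hM, Matrix.inv_def, Matrix.adjugate_fin_two, Matrix.det_fin_two]
  ext i
  fin_cases i
  · simp [Matrix.mulVec, dotProduct, Fin.sum_univ_two]
    field_simp
    ring
  · simp [Matrix.mulVec, dotProduct, Fin.sum_univ_two]
    field_simp

theorem coneChar_zero {p q : ℕ} [NeZero q]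
    (γ : (Fin 2 → ℤ) ⧸ coneLattice ![1, 0] ![(p : ℤ), (q : ℤ)]) :
    coneChar ![1, 0] ![(p : ℤ), (q : ℤ)] 0 γ =
      ZMod.stdAddChar (-(p : ZMod q) * coneQuotientEquiv p q γ) := by
  have hq : 0 < q := Nat.pos_of_neZero q
  have hqC : (q : ℂ) ≠ 0 := by exact_mod_cast hq.ne'
  rw [coneQuotientEquiv_apply, coneChar, coneCoord_eq hq]
  -- The multiple of q vanishes in `ZMod q`; with it the integer is exactly q times the first cone
  -- coordinate.
  have : (-(p : ZMod q) * (γ.out 1 : ZMod q)) = ((q * γ.out 0 - p * γ.out 1 : ℤ) : ZMod q) := by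
    push_cast; simp
  rw [this, ZMod.stdAddChar_coe]
  congr 1
  simp
  field_simp

theorem coneChar_one {p q : ℕ} [NeZero q]
    (γ : (Fin 2 → ℤ) ⧸ coneLattice ![1, 0] ![(p : ℤ), (q : ℤ)]) :
    coneChar ![1, 0] ![(p : ℤ), (q : ℤ)] 1 γ = ZMod.stdAddChar (coneQuotientEquiv p q γ) := by
  rw [coneQuotientEquiv_apply, coneChar, coneCoord_eq (Nat.pos_of_neZero q), ZMod.stdAddChar_coe]
  congr 1
  simp
  ring

theorem coeff_toddSeries_eq_sum (p q e f : ℕ) [NeZero q] :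
    MvPowerSeries.coeff (Finsupp.single 0 e + Finsupp.single 1 f)
      (toddSeries ![1, 0] ![(p : ℤ), (q : ℤ)]) =
    ∑ y : ZMod q, PowerSeries.coeff e (toddFactor (ZMod.stdAddChar (-(p : ZMod q) * y))) *
      PowerSeries.coeff f (toddFactor (ZMod.stdAddChar y)) := by
  have h : toddSeries ![1, 0] ![(p : ℤ), (q : ℤ)] = ∑ y : ZMod q,
      (toddFactor (ZMod.stdAddChar (-(p : ZMod q) * y))).subst
        (MvPowerSeries.X 0 : MvPowerSeries (Fin 2) ℂ) *
      (toddFactor (ZMod.stdAddChar y)).subst (MvPowerSeries.X 1 : MvPowerSeries (Fin 2) ℂ) := by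
    rw [toddSeries, ← finsum_eq_sum_of_fintype,
      ← finsum_comp_equiv (coneQuotientEquiv p q).toEquiv]
    refine finsum_congr fun γ => ?_
    rw [coneChar_zero, coneChar_one]
    rfl
  rw [h, map_sum]
  exact sum_congr rfl fun y _ => coeff_subst_mul_subst _ _ e f

theorem stdAddChar_pow_self {q : ℕ} [NeZero q] (y : ZMod q) :
    (ZMod.stdAddChar y : ℂ) ^ q = 1 := by
  rw [← AddChar.map_nsmul_eq_pow]; simp

/-- Expanding both factors over k and l, the sum over the group forces l ≡ pk mod q and contributes
q. With (-q)^{e+f} and the two prefactors 1/q this gives q^{e+f-1}, the sign disappearing because e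
+ f is even. -/
theorem coeff_toddSeries {p q : ℕ} (hq : 0 < q) {e f : ℕ} (hN : Even (e + f))
    (hN0 : 0 < e + f) :
    MvPowerSeries.coeff (Finsupp.single 0 e + Finsupp.single 1 f)
      (toddSeries ![1, 0] ![(p : ℤ), (q : ℤ)]) =
    ((bernoulliSum e f p q / (e.factorial * f.factorial) * q ^ (e + f - 1) : ℚ) : ℂ) := by
  have : NeZero q := ⟨hq.ne'⟩
  have hqC : (q : ℂ) ≠ 0 := by exact_mod_cast hq.ne'
  rw [coeff_toddSeries_eq_sum]
  simp_rw [coeff_toddFactor hq (stdAddChar_pow_self _)]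
  set b : ℕ → ℕ → ℂ := fun n k => (((Polynomial.bernoulli n).eval ((k : ℚ) / q) : ℚ) : ℂ) with hb
  have horth : ∀ k l : ℕ, ∑ y : ZMod q, (ZMod.stdAddChar (-(p : ZMod q) * y) : ℂ) ^ k *
      ZMod.stdAddChar y ^ l = if (l : ZMod q) = (p * k : ℕ) then (q : ℂ) else 0 := by
    intro k l
    have := AddChar.sum_mulShift (R' := ℂ) ((l : ZMod q) - (p * k : ℕ))
      (ZMod.isPrimitive_stdAddChar q)
    rw [ZMod.card] at this
    simp only [sub_eq_zero] at this
    push_cast at this ⊢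
    rw [← this]
    refine sum_congr rfl fun y _ => ?_
    rw [← AddChar.map_nsmul_eq_pow, ← AddChar.map_nsmul_eq_pow, ← AddChar.map_add_eq_mul]
    congr 1
    simp only [nsmul_eq_mul]
    ring
  have hmain : ∑ y : ZMod q,
      (∑ k ∈ range q, (ZMod.stdAddChar (-(p : ZMod q) * y) : ℂ) ^ k * b e k) *
      (∑ l ∈ range q, (ZMod.stdAddChar y : ℂ) ^ l * b f l) =
      ∑ k ∈ range q, q * (b e k * b f (p * k % q)) := by
    simp_rw [sum_mul_sum]
    rw [sum_comm]
    refine sum_congr rfl fun k _ => ?_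
    rw [sum_comm, sum_eq_single (p * k % q)]
    · have := horth k (p * k % q)
      rw [ZMod.natCast_mod, if_pos rfl] at this
      rw [← this, sum_mul]
      exact sum_congr rfl fun y _ => by ring
    · intro l hl hne
      have := horth k l
      rw [if_neg] at this
      · rw [← zero_mul (b e k * b f l), ← this, sum_mul]
        exact sum_congr rfl fun y _ => by ring
      · intro h
        rw [ZMod.natCast_eq_natCast_iff, Nat.ModEq, Nat.mod_eq_of_lt (mem_range.mp hl)] at h
        exact hne h
    · intro h
      exact absurd (mem_range.mpr (Nat.mod_lt _ hq)) h
  have hS : ((bernoulliSum e f p q : ℚ) : ℂ) = ∑ k ∈ range q, b e k * b f (p * k % q) := by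
    simp only [bernoulliSum, hb, Rat.cast_sum, Rat.cast_mul]
  have hsign : (-(q : ℂ)) ^ e * (-(q : ℂ)) ^ f = q ^ (e + f - 1) * q := by
    rw [← pow_add, hN.neg_pow, ← pow_succ, Nat.sub_add_cancel hN0]
  have hfac : ∀ y : ZMod q, (-(q : ℂ)) ^ e / (q * e.factorial) *
      (∑ k ∈ range q, (ZMod.stdAddChar (-(p : ZMod q) * y) : ℂ) ^ k * b e k) *
      ((-(q : ℂ)) ^ f / (q * f.factorial) *
        ∑ l ∈ range q, (ZMod.stdAddChar y : ℂ) ^ l * b f l) =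
      (-(q : ℂ)) ^ e * (-(q : ℂ)) ^ f / (q * e.factorial * (q * f.factorial)) *
      ((∑ k ∈ range q, (ZMod.stdAddChar (-(p : ZMod q) * y) : ℂ) ^ k * b e k) *
        ∑ l ∈ range q, (ZMod.stdAddChar y : ℂ) ^ l * b f l) := fun y => by ring
  rw [sum_congr rfl fun y _ => hfac y, ← mul_sum, hmain, ← mul_sum, ← hS, hsign]
  push_cast
  field_simp

end GenDedekind

theorem theorem1p1 (p q : ℕ) (hp : 0 < p) (hpq : p < q) (hcop : Nat.Coprime p q)
    (n : ℕ) (hn : 1 ≤ n) (a : ℕ → ℕ) (ha : ∀ k, 1 ≤ k → k ≤ n → 1 ≤ a k)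
    (hcf : GenDedekind.contFracTo a n = (q : ℚ) / (p : ℚ))
    (e f : ℕ) (he : 0 < e) (hf : 0 < f) (hN : Even (e + f)) :
    GenDedekind.dedekindSum e f p q + GenDedekind.delta e f * bernoulli e * bernoulli f =
        GenDedekind.integralPart e f p q n a / (q : ℚ) ^ (e + f - 2) +
          GenDedekind.fractionalPart e f p n a / (q : ℚ) ^ (e + f - 1) ∧
      MvPowerSeries.coeff (Finsupp.single 0 e + Finsupp.single 1 f)
          (GenDedekind.toddSeries ![1, 0] ![(p : ℤ), (q : ℤ)]) =
        (((q : ℚ) * GenDedekind.integralCoeff e f p q n a +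
            bernoulli (e + f) / ((e + f).factorial : ℚ) *
              ((e + f - 1).choose f : ℚ) * (p : ℚ) ^ f +
            bernoulli (e + f) / ((e + f).factorial : ℚ) * ((e + f - 1).choose e : ℚ) *
              ((-1) ^ (n - 1) * (GenDedekind.convQ a ((n : ℤ) - 1) : ℚ)) ^ e : ℚ) : ℂ) := by
  have hq : 0 < q := hp.trans hpq
  have hqQ : (q : ℚ) ≠ 0 := by exact_mod_cast hq.ne'
  have key := GenDedekind.bernoulliSum_eq_integralCoeff hp hcop hn ha hcf he hf hN
  refine ⟨?_, by rw [GenDedekind.coeff_toddSeries hq hN (by omega), key]⟩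
  rw [GenDedekind.dedekindSum_add_delta hq hcop, GenDedekind.integralPart,
    GenDedekind.fractionalPart]
  obtain ⟨m, hm⟩ : ∃ m, e + f = m + 2 := ⟨e + f - 2, by omega⟩
  have hfac : ((e.factorial : ℚ) * f.factorial) ≠ 0 := by positivity
  rw [mul_pow, ← pow_mul, mul_comm (n - 1) e] at key
  simp only [hm, Nat.add_sub_cancel, show m + 2 - 1 = m + 1 from rfl] at key ⊢
  rw [div_mul_eq_mul_div, div_eq_iff hfac] at key
  have hpow : (q : ℚ) ^ (m + 1) ≠ 0 := pow_ne_zero _ hqQ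
  apply mul_right_cancel₀ hpow
  rw [key]
  field_simp
  ring
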